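/- Let $(X,m)$ be a non-atomic probability space, i.e. every measurable set of positive measure contains a measurable subset of strictly smaller positive measure. Let $\tau:X\to X$ be an ergodic (measurable, measure-preserving, not necessarily invertible) transformation, and let $(n_k)_{k\ge1}$ be a non-decreasing sequence of positive integers. For $n\ge 1$ and $f\in L^2(X,m)$ (complex-valued) put $M_nf=\frac1n\sum_{j=1}^n f\circ\tau^j$, and for $\gamma\in\mathbb C$ with $|\gamma|=1$ put $m_n(\gamma)=\frac1n\sum_{j=1}^n\gamma^j$. A series $\sum_{k\ge1} x_k$ in a Banach space is called unconditionally convergent if for every permutation $\pi$ of $\{1,2,3,\dots\}$ the series $\sum_{k=1}^\infty x_{\pi(k)}$ converges in norm. Then the following are equivalent: (a) for every $f\in L^2(X,m)$ the series $\sum_{k=1}^\infty\bigl(M_{n_{k+1}}f-M_{n_k}f\bigr)$ is unconditionally convergent in $L^2(X,m)$; (b) $\displaystyle\sup_{|\gamma|=1}\ \sum_{k=1}^\infty\bigl|m_{n_{k+1}}(\gamma)-m_{n_k}(\gamma)\bigr|<\infty$. -/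

import Mathlib

open MeasureTheory Filter Topology
open scoped ENNReal

/-- The measure `m` is non-atomic: every measurable set of positive measure has a measurable subset
of strictly smaller positive measure. (Mathlib's `NullSingletonClass` only says that
singletons are null, which is weaker on a general measurable space.) -/
def IsNonatomic {X : Type*} [MeasurableSpace X] (m : Measure X) : Prop :=
  ∀ A : Set X, MeasurableSet A → 0 < m A →
    ∃ B : Set X, B ⊆ A ∧ MeasurableSet B ∧ 0 < m B ∧ m B < m A

/-- A series `∑ x k` in a normed space is unconditionally convergent if every rearrangement of it
has norm convergent partial sums. -/
def UnconditionallyConvergent {E : Type*} [NormedAddCommGroup E] (x : ℕ → E) : Prop :=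
  ∀ π : Equiv.Perm ℕ, ∃ s : E,
    Tendsto (fun N : ℕ => ∑ k ∈ Finset.range N, x (π k)) atTop (𝓝 s)

/-- The ergodic average `M_n f = (1/n) ∑_{j=1}^n f ∘ τ^j` on complex `L²(X, m)`. -/
noncomputable def ergodicAverage {X : Type*} [MeasurableSpace X] {m : Measure X} {τ : X → X}
    (hτ : MeasurePreserving τ m m) (n : ℕ) (f : Lp ℂ 2 m) : Lp ℂ 2 m :=
  (n : ℂ)⁻¹ • ∑ j ∈ Finset.Icc 1 n, Lp.compMeasurePreserving (τ^[j]) (hτ.iterate j) f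

/-- The Fourier transform `m_n(γ) = (1/n) ∑_{j=1}^n γ^j` of the average, for `γ` on the circle. -/
noncomputable def averageSymbol (n : ℕ) (γ : Circle) : ℂ :=
  (n : ℂ)⁻¹ * ∑ j ∈ Finset.Icc 1 n, (γ : ℂ) ^ j

/-! ### Polynomials in a Hilbert space isometry: norm versus symbol. -/

section Isometry

variable {H : Type*} [NormedAddCommGroup H] [InnerProductSpace ℂ H]

/-! With `T` the Koopman isometry, the differences of averages are `q k (T)`, where the polynomial
`q k` restricted to the circle is the difference of symbols. Everything rests on comparing `‖p(T)‖`
with the supremum of `|p|` on the circle. The upper bound is von Neumann's inequality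
(`norm_aeval_apply_le_of_isometry`). The lower bound uses ergodicity and non-atomicity: disjoint
towers give approximate eigenvectors for every point of the circle (`Ergodic.norm_eval_le`).

Given (a), Banach–Steinhaus bounds all finite sums of the `q k (T)`, hence those of the `q k (γ)`
uniformly in `γ`, hence the sums of absolute values. Given (b), sums with coefficients in the unit
disc are uniformly bounded, which in a Hilbert space forces summability. -/

/-- Parseval's identity for the vector-valued discrete Fourier transform. -/
lemma sum_norm_sq_dft {M : ℕ} [NeZero M] (v : ZMod M → H) :
    ∑ k : ZMod M, ‖∑ l : ZMod M, ZMod.stdAddChar (-(l * k)) • v l‖ ^ 2 =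
      M * ∑ l : ZMod M, ‖v l‖ ^ 2 := by
  have key (l l' : ZMod M) : ∑ k : ZMod M,
      (starRingEnd ℂ) (ZMod.stdAddChar (-(l * k))) * ZMod.stdAddChar (-(l' * k)) =
        if l = l' then (M : ℂ) else 0 := by
    have h := AddChar.sum_mulShift (l - l') (ZMod.isPrimitive_stdAddChar M)
    simp only [ZMod.card, sub_eq_zero, Nat.cast_ite, Nat.cast_zero] at h
    rw [← h]
    refine Finset.sum_congr rfl fun k _ => ?_
    rw [← AddChar.map_neg_eq_conj, ← AddChar.map_add_eq_mul]
    congr 1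
    ring
  have hC : ((∑ k : ZMod M, ‖∑ l : ZMod M, ZMod.stdAddChar (-(l * k)) • v l‖ ^ 2 : ℝ) : ℂ) =
      ((M * ∑ l : ZMod M, ‖v l‖ ^ 2 : ℝ) : ℂ) := by
    push_cast
    calc ∑ k : ZMod M, ((‖∑ l : ZMod M, ZMod.stdAddChar (-(l * k)) • v l‖ : ℝ) : ℂ) ^ 2
        = ∑ k : ZMod M, ∑ l : ZMod M, ∑ l' : ZMod M,
            ((starRingEnd ℂ) (ZMod.stdAddChar (-(l * k))) * ZMod.stdAddChar (-(l' * k))) *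
              inner ℂ (v l) (v l') := by
          refine Finset.sum_congr rfl fun k _ => ?_
          have := inner_self_eq_norm_sq_to_K (𝕜 := ℂ)
            (∑ l : ZMod M, ZMod.stdAddChar (-(l * k)) • v l)
          rw [← Complex.coe_algebraMap, ← RCLike.algebraMap_eq_ofReal] at *
          rw [← this, sum_inner]
          refine Finset.sum_congr rfl fun l _ => ?_
          rw [inner_sum]
          refine Finset.sum_congr rfl fun l' _ => ?_
          rw [inner_smul_left, inner_smul_right, mul_assoc]
      _ = ∑ l : ZMod M, ∑ l' : ZMod M, (if l = l' then (M : ℂ) else 0) *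
              inner ℂ (v l) (v l') := by
          rw [Finset.sum_comm]
          refine Finset.sum_congr rfl fun l _ => ?_
          rw [Finset.sum_comm]
          refine Finset.sum_congr rfl fun l' _ => ?_
          rw [← Finset.sum_mul, key]
      _ = _ := by
          simp [Finset.mul_sum, inner_self_eq_norm_sq_to_K]
  exact_mod_cast hC

/-- A cyclic convolution operator is bounded by the supremum of its symbol. -/
lemma sum_norm_sq_cyclic_le {M : ℕ} [NeZero M] (v : ZMod M → H) (p : Polynomial ℂ) {C : ℝ}
    (hp : ∀ z : Circle, ‖p.eval (z : ℂ)‖ ≤ C) :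
    ∑ m : ZMod M, ‖∑ i ∈ Finset.range (p.natDegree + 1), p.coeff i • v (m + i)‖ ^ 2 ≤
      C ^ 2 * ∑ l : ZMod M, ‖v l‖ ^ 2 := by
  have hM : (0 : ℝ) < M := by exact_mod_cast Nat.pos_of_ne_zero (NeZero.ne M)
  set w : ZMod M → H := fun m => ∑ i ∈ Finset.range (p.natDegree + 1), p.coeff i • v (m + i)
  -- The transform turns the shift by `i` into multiplication by the `i`-th power of the character.
  have hF (k : ZMod M) : ∑ m : ZMod M, ZMod.stdAddChar (-(m * k)) • w m =
      p.eval (ZMod.stdAddChar k) • ∑ l : ZMod M, ZMod.stdAddChar (-(l * k)) • v l := by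
    simp only [w, Finset.smul_sum]
    rw [Finset.sum_comm, Polynomial.eval_eq_sum_range, ← Finset.smul_sum, Finset.sum_smul]
    refine Finset.sum_congr rfl fun i _ => ?_
    rw [Finset.smul_sum]
    rw [← Equiv.sum_comp (Equiv.subRight (i : ZMod M))]
    refine Finset.sum_congr rfl fun l _ => ?_
    simp only [Equiv.subRight_apply, sub_add_cancel, smul_smul]
    rw [← AddChar.map_nsmul_eq_pow, show -((l - i) * k) = i • k + -(l * k) by
      rw [nsmul_eq_mul]
      ring, AddChar.map_add_eq_mul]
    ring_nf
  refine le_of_mul_le_mul_left ?_ hM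
  calc (M : ℝ) * ∑ m : ZMod M, ‖w m‖ ^ 2
      = ∑ k : ZMod M, ‖p.eval (ZMod.stdAddChar k) •
          ∑ l : ZMod M, ZMod.stdAddChar (-(l * k)) • v l‖ ^ 2 := by
        rw [← sum_norm_sq_dft]; simp only [hF]
    _ ≤ ∑ k : ZMod M, C ^ 2 * ‖∑ l : ZMod M, ZMod.stdAddChar (-(l * k)) • v l‖ ^ 2 := by
        refine Finset.sum_le_sum fun k _ => ?_
        rw [norm_smul, mul_pow]
        gcongr
        exact hp (ZMod.toCircle k)
    _ = _ := by rw [← Finset.mul_sum, sum_norm_sq_dft]; ring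

lemma norm_pow_apply_of_isometry {T : H →L[ℂ] H} (hT : ∀ x, ‖T x‖ = ‖x‖) (n : ℕ) (x : H) :
    ‖(T ^ n) x‖ = ‖x‖ := by
  induction n with
  | zero => simp
  | succ n ih => rw [pow_succ', mul_apply_eq_comp, hT, ih]

/-- Von Neumann's inequality for an isometry. -/
lemma norm_aeval_apply_le_of_isometry {T : H →L[ℂ] H} (hT : ∀ x, ‖T x‖ = ‖x‖)
    (p : Polynomial ℂ) {C : ℝ} (hp : ∀ z : Circle, ‖p.eval (z : ℂ)‖ ≤ C) (x : H) :
    ‖Polynomial.aeval T p x‖ ≤ C * ‖x‖ := by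
  have hC : 0 ≤ C := (norm_nonneg _).trans (hp 1)
  set d := p.natDegree
  set y := Polynomial.aeval T p x
  have hy (n : ℕ) : (T ^ n) y = ∑ i ∈ Finset.range (d + 1), p.coeff i • (T ^ (n + i)) x := by
    simp [y, d, Polynomial.aeval_eq_sum_range, pow_add]
  have hfin (N : ℕ) : (N : ℝ) * ‖y‖ ^ 2 ≤ (N + d + 1) * (C ^ 2 * ‖x‖ ^ 2) := by
    -- Lay the orbit of `x` on a cycle of length `M`. For `n < N` and `i ≤ d` the index `n + i` does
    -- not wrap around, so the cyclic convolution there equals `(T ^ n) y`. The `d + 1` extra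
    -- positions are negligible as `N` grows.
    let M := N + d + 1
    have : NeZero M := ⟨by simp [M]⟩
    have h := sum_norm_sq_cyclic_le (M := M) (fun l => (T ^ l.val) x) p hp
    simp only [norm_pow_apply_of_isometry hT, Finset.sum_const, Finset.card_univ, ZMod.card,
      nsmul_eq_mul] at h
    have hinj : Set.InjOn (fun n : ℕ => (n : ZMod M)) (Finset.range N : Set ℕ) := by
      intro a ha b hb hab
      simp only [Finset.coe_range, Set.mem_Iio] at ha hb
      have := congrArg ZMod.val hab
      rwa [ZMod.val_natCast_of_lt (by omega), ZMod.val_natCast_of_lt (by omega)] at this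
    have hlow : (N : ℝ) * ‖y‖ ^ 2 ≤ ∑ m : ZMod M,
        ‖∑ i ∈ Finset.range (p.natDegree + 1), p.coeff i • (T ^ (m + (i : ZMod M)).val) x‖ ^ 2 := by
      calc (N : ℝ) * ‖y‖ ^ 2 = ∑ n ∈ Finset.range N, ‖(T ^ n) y‖ ^ 2 := by
            simp only [norm_pow_apply_of_isometry hT, Finset.sum_const, Finset.card_range,
              nsmul_eq_mul]
        _ = ∑ m ∈ (Finset.range N).image (fun n : ℕ => (n : ZMod M)),
            ‖∑ i ∈ Finset.range (p.natDegree + 1),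
              p.coeff i • (T ^ (m + (i : ZMod M)).val) x‖ ^ 2 := by
            rw [Finset.sum_image hinj]
            refine Finset.sum_congr rfl fun n hn => ?_
            rw [hy]
            congr 2
            refine Finset.sum_congr rfl fun i hi => ?_
            rw [Finset.mem_range] at hn hi
            rw [← Nat.cast_add, ZMod.val_natCast_of_lt (by omega)]
        _ ≤ _ := Finset.sum_le_sum_of_subset_of_nonneg (Finset.subset_univ _)
            fun _ _ _ => by positivity
    refine (hlow.trans h).trans_eq ?_
    simp only [M]; push_cast; ring
  have hsq : ‖y‖ ^ 2 ≤ (C * ‖x‖) ^ 2 := by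
    by_contra! hlt
    rw [mul_pow] at hlt
    obtain ⟨N, hN⟩ := exists_nat_gt
      ((d + 1) * (C ^ 2 * ‖x‖ ^ 2) / (‖y‖ ^ 2 - C ^ 2 * ‖x‖ ^ 2))
    rw [div_lt_iff₀ (by linarith)] at hN
    have := hfin N
    linarith
  exact le_of_sq_le_sq hsq (by positivity)

/-- If the first `N` iterates of `g` under an isometry are orthogonal, then every point of the
circle is an approximate eigenvalue, up to an error of order `1 / √N`. -/
lemma exists_approx_eigenvector {T : H →L[ℂ] H} (hT : ∀ x, ‖T x‖ = ‖x‖) {g : H} (hg : g ≠ 0)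
    {N : ℕ} (hN : 0 < N)
    (horth : ∀ i < N, ∀ j < N, i ≠ j → inner ℂ ((T ^ i) g) ((T ^ j) g) = 0) (γ : Circle) :
    ∃ f : H, f ≠ 0 ∧ √N * ‖T f - (γ : ℂ) • f‖ ≤ 2 * ‖f‖ := by
  -- For this twisted sum `T f - γ • f` telescopes to two boundary terms, while orthogonality makes
  -- `‖f‖ = √N * ‖g‖`.
  set f : H := ∑ j ∈ Finset.range N, ((γ : ℂ)⁻¹ ^ j) • (T ^ j) g with hf
  have hnorm : ‖f‖ ^ 2 = N * ‖g‖ ^ 2 := by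
    have h : ∀ n ≤ N, ‖∑ j ∈ Finset.range n, ((γ : ℂ)⁻¹ ^ j) • (T ^ j) g‖ ^ 2 =
        n * ‖g‖ ^ 2 := by
      intro n hn
      induction n with
      | zero => simp
      | succ n ih =>
        rw [Finset.sum_range_succ, sq, norm_add_sq_eq_norm_sq_add_norm_sq_of_inner_eq_zero
          (𝕜 := ℂ), ← sq, ← sq, ih (by omega), norm_smul, norm_pow_apply_of_isometry hT]
        · simp [Circle.norm_coe, add_one_mul]
        · rw [sum_inner]
          refine Finset.sum_eq_zero fun j hj => ?_
          rw [Finset.mem_range] at hj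
          rw [inner_smul_left, inner_smul_right, horth j (by omega) n (by omega) hj.ne]
          simp
    exact h N le_rfl
  have hfg : ‖f‖ = √N * ‖g‖ := by
    rw [← Real.sqrt_sq (norm_nonneg f), hnorm, Real.sqrt_mul (by positivity),
      Real.sqrt_sq (norm_nonneg g)]
  refine ⟨f, ?_, ?_⟩
  · rw [← norm_pos_iff, hfg]
    have := norm_pos_iff.2 hg
    have : (0 : ℝ) < N := by exact_mod_cast hN
    positivity
  · have hγ : (γ : ℂ) ≠ 0 := γ.coe_ne_zero
    have hdiff : T f - (γ : ℂ) • f =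
        (γ : ℂ) • (((γ : ℂ)⁻¹ ^ N) • (T ^ N) g - g) := by
      have h1 : T f = (γ : ℂ) • ∑ j ∈ Finset.range N, ((γ : ℂ)⁻¹ ^ (j + 1)) • (T ^ (j + 1)) g := by
        rw [hf, map_sum, Finset.smul_sum]
        refine Finset.sum_congr rfl fun j _ => ?_
        rw [map_smul, smul_smul, pow_succ' T, mul_apply_eq_comp]
        rw [pow_succ', mul_inv_cancel_left₀ hγ]
      rw [h1, hf, ← smul_sub, ← Finset.sum_sub_distrib,
        Finset.sum_range_sub (fun j => ((γ : ℂ)⁻¹ ^ j) • (T ^ j) g)]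
      simp
    have : ‖T f - (γ : ℂ) • f‖ ≤ 2 * ‖g‖ := by
      rw [hdiff, norm_smul, Circle.norm_coe, one_mul, two_mul]
      refine (norm_sub_le _ _).trans (add_le_add ?_ le_rfl)
      rw [norm_smul, norm_pow_apply_of_isometry hT]
      simp [Circle.norm_coe]
    rw [hfg]
    nlinarith [Real.sqrt_nonneg N]

/-- If `x` is nearly an eigenvector of `T` for `z`, then so it is of `p(T)` for `p(z)`. -/
lemma exists_norm_aeval_sub_le (T : H →L[ℂ] H) (p : Polynomial ℂ) (z : ℂ) :
    ∃ K : ℝ, 0 ≤ K ∧ ∀ x, ‖Polynomial.aeval T p x - p.eval z • x‖ ≤ K * ‖T x - z • x‖ := by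
  obtain ⟨q, hq⟩ := Polynomial.X_sub_C_dvd_sub_C_eval (a := z) (p := p)
  refine ⟨‖Polynomial.aeval T q‖, norm_nonneg _, fun x => ?_⟩
  have h : Polynomial.aeval T (p - Polynomial.C (p.eval z)) x =
      Polynomial.aeval T q (Polynomial.aeval T (Polynomial.X - Polynomial.C z) x) := by
    rw [hq, mul_comm, map_mul, mul_apply_eq_comp]
  simp only [map_sub, Polynomial.aeval_C, Polynomial.aeval_X, sub_apply,
    Algebra.algebraMap_eq_smul_one, smul_apply,
    one_apply_eq_self] at h
  rw [h, ← map_sub]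
  exact (Polynomial.aeval T q).le_opNorm _

/-- The values of a polynomial at approximate eigenvalues of `T` are bounded by the operator norm
of `p(T)`. -/
lemma norm_eval_le_of_approx_eigenvalue {T : H →L[ℂ] H} {z : ℂ}
    (hz : ∀ N : ℕ, 0 < N → ∃ f : H, f ≠ 0 ∧ √N * ‖T f - z • f‖ ≤ 2 * ‖f‖)
    (p : Polynomial ℂ) : ‖p.eval z‖ ≤ ‖Polynomial.aeval T p‖ := by
  obtain ⟨K, hK, hKx⟩ := exists_norm_aeval_sub_le T p z
  refine le_of_forall_pos_le_add fun ε hε => ?_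
  obtain ⟨N, hN⟩ := exists_nat_gt ((2 * K / ε) ^ 2)
  have hN0 : (0 : ℝ) < N := lt_of_le_of_lt (by positivity) hN
  obtain ⟨f, hf, hfN⟩ := hz N (by exact_mod_cast hN0)
  have hf' : 0 < ‖f‖ := norm_pos_iff.2 hf
  have hs : 2 * K / ε < √N := Real.lt_sqrt_of_sq_lt hN
  have hs0 : 0 < √(N : ℝ) := Real.sqrt_pos.2 hN0
  rw [div_lt_iff₀ hε] at hs
  have h1 : K * ‖T f - z • f‖ ≤ ε * ‖f‖ := by
    refine le_of_mul_le_mul_left ?_ hs0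
    calc √N * (K * ‖T f - z • f‖) = K * (√N * ‖T f - z • f‖) := by ring
      _ ≤ K * (2 * ‖f‖) := by gcongr
      _ = (2 * K) * ‖f‖ := by ring
      _ ≤ (√N * ε) * ‖f‖ := by gcongr
      _ = _ := by ring
  refine le_of_mul_le_mul_right ?_ hf'
  calc ‖p.eval z‖ * ‖f‖ = ‖p.eval z • f‖ := (norm_smul _ _).symm
    _ ≤ ‖Polynomial.aeval T p f‖ + ‖Polynomial.aeval T p f - p.eval z • f‖ := by
        have := norm_sub_le (Polynomial.aeval T p f) (Polynomial.aeval T p f - p.eval z • f)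
        rwa [sub_sub_cancel] at this
    _ ≤ ‖Polynomial.aeval T p‖ * ‖f‖ + ε * ‖f‖ :=
        add_le_add ((Polynomial.aeval T p).le_opNorm f) ((hKx f).trans h1)
    _ = _ := by ring

end Isometry

/-! ### Unconditional convergence, summability and bounded finite sums. -/

section Series

/-- An injective key on `ℕ` is increasing along some enumeration of `ℕ`. -/
lemma exists_perm_image_range_eq {key : ℕ → ℕ} (hkey : Function.Injective key) :
    ∃ π : Equiv.Perm ℕ, ∀ (t : ℕ) (S : Finset ℕ), (∀ n, n ∈ S ↔ key n < t) →
      (Finset.range S.card).image π = S := by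
  have : Infinite (Set.range key) := (Set.infinite_range_of_injective hkey).to_subtype
  classical
  let e : ℕ ≃o Set.range key := Nat.Subtype.orderIsoOfNat (Set.range key)
  let π : Equiv.Perm ℕ := e.toEquiv.trans (Equiv.ofInjective key hkey).symm
  have hπ (i : ℕ) : key (π i) = e i := by
    have := (Equiv.ofInjective key hkey).apply_symm_apply (e i)
    exact congrArg Subtype.val this
  refine ⟨π, fun t S hS => ?_⟩
  symm
  refine Finset.eq_of_subset_of_card_le (fun n hn => ?_) ?_
  · obtain ⟨i, rfl⟩ := π.surjective n
    refine Finset.mem_image_of_mem _ (Finset.mem_range.2 ?_)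
    -- The set `S` is closed under passing to smaller keys, so it contains everything enumerated up
    -- to `π i`; counting gives `i < S.card`.
    have hsub : (Finset.range (i + 1)).image π ⊆ S := by
      intro a ha
      obtain ⟨j, hj, rfl⟩ := Finset.mem_image.1 ha
      rw [hS] at hn ⊢
      refine lt_of_le_of_lt ?_ hn
      rw [hπ, hπ]
      exact e.monotone (by simpa [Nat.lt_succ_iff] using hj)
    have := Finset.card_le_card hsub
    rw [Finset.card_image_of_injective _ π.injective, Finset.card_range] at this
    omega
  · rw [Finset.card_image_of_injective _ π.injective, Finset.card_range]

/-- Given a strictly increasing sequence cutting `ℕ` into blocks and a subset of each block, some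
permutation of `ℕ` enumerates the blocks in order, the chosen subset of each block coming first. -/
lemma exists_perm_of_blocks {B : ℕ → ℕ} (hB0 : B 0 = 0) (hB : StrictMono B)
    {T : ℕ → Finset ℕ} (hT : ∀ b, T b ⊆ Finset.Ico (B b) (B (b + 1))) :
    ∃ π : Equiv.Perm ℕ, ∀ b, (Finset.range (B b)).image π = Finset.range (B b) ∧
      (Finset.range (B b + (T b).card)).image π = Finset.range (B b) ∪ T b := by
  classical
  have hex (n : ℕ) : ∃ b, B b ≤ n ∧ n < B (b + 1) := by
    refine ⟨Nat.findGreatest (fun b => B b ≤ n) n,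
      Nat.findGreatest_spec (P := fun b => B b ≤ n) (Nat.zero_le n) (by simp [hB0]), ?_⟩
    by_contra! h
    have := Nat.le_findGreatest (P := fun b => B b ≤ n) ((hB.le_apply).trans h) h
    omega
  choose β hβ hβ' using hex
  have hmono (a b : ℕ) (h : a < b) : B (a + 1) ≤ B b := hB.monotone h
  -- In block `b` the chosen elements get keys in `[2 B b, B b + B (b+1))` and the others keys in
  -- `[B b + B (b+1), 2 B (b+1))`.
  let key (n : ℕ) : ℕ := if n ∈ T (β n) then n + B (β n) else n + B (β n + 1)
  have hkeyT {n : ℕ} (h : n ∈ T (β n)) : key n = n + B (β n) := if_pos h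
  have hkeyF {n : ℕ} (h : n ∉ T (β n)) : key n = n + B (β n + 1) := if_neg h
  have hlow (n : ℕ) : 2 * B (β n) ≤ key n := by
    have := hβ n; have := hβ' n
    by_cases h : n ∈ T (β n)
    · rw [hkeyT h]; omega
    · rw [hkeyF h]; omega
  have hupp (n : ℕ) : key n < 2 * B (β n + 1) := by
    have := hβ n; have := hβ' n
    by_cases h : n ∈ T (β n)
    · rw [hkeyT h]; omega
    · rw [hkeyF h]; omega
  have hinj : Function.Injective key := by
    intro m n hmn
    have hmm := hlow m; have hmu := hupp m; have hnl := hlow n; have hnu := hupp n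
    have hb : β m = β n := by
      rcases lt_trichotomy (β m) (β n) with h | h | h
      · have := hmono _ _ h; omega
      · exact h
      · have := hmono _ _ h; omega
    have h1 := hβ m; have h2 := hβ' m; have h3 := hβ n; have h4 := hβ' n
    by_cases hm : m ∈ T (β m) <;> by_cases hn : n ∈ T (β n)
    · rw [hkeyT hm, hkeyT hn] at hmn; rw [hb] at hmn; omega
    · rw [hkeyT hm, hkeyF hn] at hmn; rw [hb] at hmn h1 h2; omega
    · rw [hkeyF hm, hkeyT hn] at hmn; rw [hb] at hmn h1 h2; omega
    · rw [hkeyF hm, hkeyF hn] at hmn; rw [hb] at hmn; omega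
  obtain ⟨π, hπ⟩ := exists_perm_image_range_eq hinj
  refine ⟨π, fun b => ⟨?_, ?_⟩⟩
  · have := hπ (2 * B b) (Finset.range (B b)) fun n => ?_
    · rwa [Finset.card_range] at this
    have h1 := hβ n; have h2 := hβ' n; have h3 := hlow n; have h4 := hupp n
    rw [Finset.mem_range]
    rcases lt_or_ge (β n) b with h | h
    · have := hmono _ _ h; omega
    · have := hB.monotone h; omega
  · have hdisj : Disjoint (Finset.range (B b)) (T b) := by
      rw [Finset.disjoint_left]
      intro a ha ha'
      have := Finset.mem_Ico.1 (hT b ha')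
      rw [Finset.mem_range] at ha
      omega
    have := hπ (B b + B (b + 1)) (Finset.range (B b) ∪ T b) fun n => ?_
    · rwa [Finset.card_union_of_disjoint hdisj, Finset.card_range] at this
    have h1 := hβ n; have h2 := hβ' n; have h3 := hlow n; have h4 := hupp n
    have hlt : B b < B (b + 1) := hB (Nat.lt_succ_self b)
    rw [Finset.mem_union, Finset.mem_range]
    rcases lt_trichotomy (β n) b with h | h | h
    · have := hmono _ _ h
      exact ⟨fun _ => by omega, fun _ => Or.inl (by omega)⟩
    · subst h
      by_cases hn : n ∈ T (β n)
      · rw [hkeyT hn]; exact ⟨fun _ => by omega, fun _ => Or.inr hn⟩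
      · rw [hkeyF hn]
        refine ⟨fun h => ?_, fun h => by omega⟩
        rcases h with h | h
        · omega
        · exact absurd h hn
    · have := hmono _ _ h
      refine ⟨fun h' => ?_, fun h' => by omega⟩
      rcases h' with h' | h'
      · omega
      · have := Finset.mem_Ico.1 (hT b h'); omega

variable {E : Type*} [NormedAddCommGroup E]

lemma exists_large_disjoint_sum_of_not_summable [CompleteSpace E] {ι : Type*} {x : ι → E}
    (hx : ¬ Summable x) :
    ∃ ε > 0, ∀ s : Finset ι, ∃ t : Finset ι, Disjoint t s ∧ ε ≤ ‖∑ i ∈ t, x i‖ := by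
  rw [summable_iff_vanishing_norm] at hx
  push Not at hx
  exact hx

/-- If summability fails, there are finite sets arbitrarily far out with sums of norm at least `ε`.
A rearrangement making each of them consecutive violates the Cauchy criterion. -/
lemma UnconditionallyConvergent.summable [CompleteSpace E] {x : ℕ → E}
    (hx : UnconditionallyConvergent x) : Summable x := by
  classical
  by_contra hns
  obtain ⟨ε, hε, h⟩ := exists_large_disjoint_sum_of_not_summable hns
  choose t ht hεt using fun N : ℕ => h (Finset.range N)
  let B : ℕ → ℕ := fun b => Nat.rec 0 (fun _ N => N + (t N).sup id + 1) b
  have hBs (b : ℕ) : B (b + 1) = B b + (t (B b)).sup id + 1 := rfl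
  have hB : StrictMono B := strictMono_nat_of_lt_succ fun b => by rw [hBs]; omega
  obtain ⟨π, hπ⟩ := exists_perm_of_blocks (T := fun b => t (B b)) rfl hB fun b n hn => by
    have h1 : n ∉ Finset.range (B b) := Finset.disjoint_left.1 (ht (B b)) hn
    have h2 : n ≤ (t (B b)).sup id := Finset.le_sup (f := id) hn
    rw [Finset.mem_range] at h1
    rw [Finset.mem_Ico, hBs]
    omega
  obtain ⟨s, hs⟩ := hx π
  obtain ⟨N, hN⟩ := Metric.cauchySeq_iff.1 hs.cauchySeq ε hε
  have hNB : N ≤ B N := hB.id_le N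
  have hsum (n : ℕ) : ∑ k ∈ Finset.range n, x (π k) = ∑ k ∈ (Finset.range n).image π, x k :=
    (Finset.sum_image π.injective.injOn).symm
  have := hN (B N + (t (B N)).card) (by omega) (B N) hNB
  rw [hsum, hsum, (hπ N).1, (hπ N).2, Finset.sum_union (ht (B N)).symm, dist_eq_norm,
    add_sub_cancel_left] at this
  exact absurd (hεt (B N)) (not_le.2 this)

lemma Summable.unconditionallyConvergent {x : ℕ → E} (hx : Summable x) :
    UnconditionallyConvergent x := fun π =>
  ⟨_, ((π.summable_iff (f := x)).2 hx).hasSum.tendsto_sum_nat⟩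

lemma unconditionallyConvergent_iff_summable [CompleteSpace E] {x : ℕ → E} :
    UnconditionallyConvergent x ↔ Summable x :=
  ⟨UnconditionallyConvergent.summable, Summable.unconditionallyConvergent⟩

lemma Summable.exists_norm_sum_le [CompleteSpace E] {ι : Type*} {x : ι → E} (hx : Summable x) :
    ∃ C : ℝ, ∀ F : Finset ι, ‖∑ i ∈ F, x i‖ ≤ C := by
  classical
  obtain ⟨s, hs⟩ := summable_iff_vanishing_norm.1 hx 1 one_pos
  refine ⟨∑ i ∈ s, ‖x i‖ + 1, fun F => ?_⟩
  rw [← Finset.sum_inter_add_sum_sdiff F s]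
  refine (norm_add_le _ _).trans (add_le_add ?_ (hs _ Finset.sdiff_disjoint).le)
  exact (norm_sum_le _ _).trans (Finset.sum_le_sum_of_subset_of_nonneg
    Finset.inter_subset_right fun _ _ _ => norm_nonneg _)

/-- In a Hilbert space, a weakly unconditionally Cauchy series is summable. -/
lemma summable_of_forall_norm_sum_smul_le {H : Type*} [NormedAddCommGroup H]
    [InnerProductSpace ℂ H] [CompleteSpace H] {ι : Type*} {x : ι → H} {C : ℝ}
    (hC : ∀ (F : Finset ι) (c : ι → ℂ), (∀ i, ‖c i‖ ≤ 1) → ‖∑ i ∈ F, c i • x i‖ ≤ C) :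
    Summable x := by
  classical
  by_contra hns
  obtain ⟨ε, hε, h⟩ := exists_large_disjoint_sum_of_not_summable hns
  -- Append disjoint large sums one at a time, each with the sign making the real part of the inner
  -- product with the previous sum nonnegative; the squared norm then grows by at least `ε ^ 2`.
  have hind (n : ℕ) : ∃ (F : Finset ι) (c : ι → ℂ), (∀ i, ‖c i‖ ≤ 1) ∧
      n * ε ^ 2 ≤ ‖∑ i ∈ F, c i • x i‖ ^ 2 := by
    induction n with
    | zero => exact ⟨∅, 0, by simp, by simp⟩
    | succ n ih =>
      obtain ⟨F, c, hc, hF⟩ := ih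
      obtain ⟨t, ht, hεt⟩ := h F
      set s := ∑ i ∈ F, c i • x i
      set y := ∑ i ∈ t, x i
      obtain ⟨σ, hσ, hsy⟩ : ∃ σ : ℂ, ‖σ‖ ≤ 1 ∧ ‖s‖ ^ 2 + ‖y‖ ^ 2 ≤ ‖s + σ • y‖ ^ 2 := by
        rcases le_total 0 (RCLike.re (inner ℂ s y)) with h0 | h0
        · refine ⟨1, by simp, ?_⟩
          rw [one_smul, @norm_add_sq ℂ]
          linarith
        · refine ⟨-1, by simp, ?_⟩
          rw [neg_one_smul, ← sub_eq_add_neg, @norm_sub_sq ℂ]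
          linarith
      refine ⟨F ∪ t, fun i => if i ∈ F then c i else σ, fun i => ?_, ?_⟩
      · dsimp only
        split_ifs
        exacts [hc i, hσ]
      · rw [Finset.sum_union ht.symm]
        have h1 : ∑ i ∈ F, (if i ∈ F then c i else σ) • x i = s :=
          Finset.sum_congr rfl fun i hi => by rw [if_pos hi]
        have h2 : ∑ i ∈ t, (if i ∈ F then c i else σ) • x i = σ • y := by
          rw [Finset.smul_sum]
          exact Finset.sum_congr rfl fun i hi => by rw [if_neg (Finset.disjoint_left.1 ht hi)]
        rw [h1, h2]
        have : ε ^ 2 ≤ ‖y‖ ^ 2 := by gcongr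
        push_cast
        linarith
  obtain ⟨n, hn⟩ := exists_nat_gt (C ^ 2 / ε ^ 2)
  obtain ⟨F, c, hc, hF⟩ := hind n
  rw [div_lt_iff₀ (by positivity)] at hn
  have : ‖∑ i ∈ F, c i • x i‖ ^ 2 ≤ C ^ 2 := by gcongr; exact hC F c hc
  linarith

lemma sum_abs_le_of_forall_abs_sum_le {ι : Type*} {a : ι → ℝ} {C : ℝ}
    (h : ∀ F : Finset ι, |∑ i ∈ F, a i| ≤ C) (F : Finset ι) : ∑ i ∈ F, |a i| ≤ 2 * C := by
  classical
  rw [← Finset.sum_filter_add_sum_filter_not F (fun i => 0 ≤ a i), two_mul]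
  refine add_le_add ?_ ?_
  · refine le_trans (le_of_eq ?_) ((le_abs_self _).trans (h (F.filter fun i => 0 ≤ a i)))
    exact Finset.sum_congr rfl fun i hi => abs_of_nonneg (Finset.mem_filter.1 hi).2
  · refine le_trans (le_of_eq ?_) ((neg_le_abs _).trans (h (F.filter fun i => ¬ 0 ≤ a i)))
    rw [← Finset.sum_neg_distrib]
    exact Finset.sum_congr rfl fun i hi => abs_of_neg (not_le.1 (Finset.mem_filter.1 hi).2)

/-- Real and imaginary parts cost `2 * C` each, one `C` per sign. -/
lemma sum_norm_le_of_forall_norm_sum_le {ι : Type*} {a : ι → ℂ} {C : ℝ}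
    (h : ∀ F : Finset ι, ‖∑ i ∈ F, a i‖ ≤ C) (F : Finset ι) : ∑ i ∈ F, ‖a i‖ ≤ 4 * C := by
  have hre := sum_abs_le_of_forall_abs_sum_le (a := fun i => (a i).re) (C := C) (fun F => by
    rw [← Complex.re_sum]; exact (Complex.abs_re_le_norm _).trans (h F)) F
  have him := sum_abs_le_of_forall_abs_sum_le (a := fun i => (a i).im) (C := C) (fun F => by
    rw [← Complex.im_sum]; exact (Complex.abs_im_le_norm _).trans (h F)) F
  have := Finset.sum_le_sum fun i (_ : i ∈ F) => Complex.norm_le_abs_re_add_abs_im (a i)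
  rw [Finset.sum_add_distrib] at this
  linarith

end Series

/-! ### Towers for ergodic maps and the Koopman operator. -/

section Dynamics

variable {X : Type*} [MeasurableSpace X] {m : Measure X}

/-- Splitting a set into two pieces of positive measure and keeping the smaller at least halves the
measure; iterate. -/
lemma IsNonatomic.exists_measure_lt [IsProbabilityMeasure m] (hm : IsNonatomic m) {ε : ℝ≥0∞}
    (hε : 0 < ε) : ∃ B : Set X, MeasurableSet B ∧ 0 < m B ∧ m B < ε := by
  have h (n : ℕ) : ∃ B : Set X, MeasurableSet B ∧ 0 < m B ∧ m B ≤ (2⁻¹ : ℝ≥0∞) ^ n := by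
    induction n with
    | zero => exact ⟨Set.univ, .univ, by simp, by simp⟩
    | succ n ih =>
      obtain ⟨B, hB, hB0, hBn⟩ := ih
      obtain ⟨D, hDB, hD, hD0, hDlt⟩ := hm B hB hB0
      have hadd : m D + m (B \ D) = m B := by
        rw [measure_add_sdiff hD.nullMeasurableSet, Set.union_eq_self_of_subset_left hDB]
      have hsmall : m B / 2 ≤ (2⁻¹ : ℝ≥0∞) ^ (n + 1) := by
        rw [pow_succ, div_eq_mul_inv]; gcongr
      rcases le_total (m D) (m B / 2) with hle | hle
      · exact ⟨D, hD, hD0, hle.trans hsmall⟩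
      · refine ⟨B \ D, hB.diff hD, ?_, ?_⟩
        · rw [pos_iff_ne_zero]
          intro h0
          rw [h0, add_zero] at hadd
          exact hDlt.ne hadd
        · refine le_trans ?_ hsmall
          by_contra! hlt
          have := ENNReal.add_lt_add_of_le_of_lt
            (ENNReal.div_ne_top (measure_ne_top m B) two_ne_zero) hle hlt
          rw [hadd, ENNReal.add_halves] at this
          exact lt_irrefl _ this
  obtain ⟨n, hn⟩ := ENNReal.exists_inv_two_pow_lt hε.ne'
  obtain ⟨B, hB, hB0, hBn⟩ := h n
  exact ⟨B, hB, hB0, hBn.trans_lt hn⟩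

/-- A weak form of Rokhlin's lemma: an ergodic map of a non-atomic space has towers of arbitrary
height with a base of positive measure. -/
lemma Ergodic.exists_disjoint_preimages [IsProbabilityMeasure m] (hm : IsNonatomic m) {τ : X → X}
    (hτ : Ergodic τ m) (N : ℕ) :
    ∃ A : Set X, MeasurableSet A ∧ 0 < m A ∧
      ∀ i < N, ∀ j < N, i ≠ j → Disjoint (τ^[i] ⁻¹' A) (τ^[j] ⁻¹' A) := by
  obtain ⟨B, hB, hB0, hBN⟩ := hm.exists_measure_lt (ε := (N + 1 : ℝ≥0∞)⁻¹) (by simp)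
  have hpre (k : ℕ) : MeasurableSet (τ^[k] ⁻¹' B) := hτ.measurable.iterate k hB
  let U : Set X := ⋃ k, τ^[k] ⁻¹' B
  -- `D k` is the set of points whose first visit to `B`, counting time `0`, occurs at time `k`.
  let D : ℕ → Set X := fun k => τ^[k] ⁻¹' B \ ⋃ i < k, τ^[i] ⁻¹' B
  have hD (k : ℕ) : MeasurableSet (D k) :=
    (hpre k).diff (.iUnion fun i => .iUnion fun _ => hpre i)
  have hmemD {k : ℕ} {x : X} : x ∈ D k ↔ τ^[k] x ∈ B ∧ ∀ i < k, τ^[i] x ∉ B := by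
    simp [D]
  have hU : m U = 1 := by
    have hsub : τ ⁻¹' U ⊆ U := by
      intro x hx
      obtain ⟨k, hk⟩ := Set.mem_iUnion.1 hx
      exact Set.mem_iUnion.2 ⟨k + 1, hk⟩
    rcases hτ.ae_empty_or_univ_of_preimage_ae_le (MeasurableSet.iUnion hpre).nullMeasurableSet
      hsub.eventuallyLE with h | h
    · have h0 : m U = 0 := by rw [measure_congr h, measure_empty]
      have : m B ≤ m U := measure_mono fun x hx => Set.mem_iUnion.2 ⟨0, hx⟩
      rw [h0] at this
      exact absurd hB0 (not_lt.2 this)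
    · rw [measure_congr h, measure_univ]
  have hUsub : U ⊆ (⋃ i ∈ Finset.range N, τ^[i] ⁻¹' B) ∪ ⋃ k, D (N + k) := by
    classical
    intro x hx
    have hex : ∃ k, τ^[k] x ∈ B := Set.mem_iUnion.1 hx
    rcases lt_or_ge (Nat.find hex) N with h | h
    · left
      simp only [Set.mem_iUnion]
      exact ⟨Nat.find hex, Finset.mem_range.2 h, Nat.find_spec hex⟩
    · right
      refine Set.mem_iUnion.2 ⟨Nat.find hex - N, ?_⟩
      rw [Nat.add_sub_cancel' h, hmemD]
      exact ⟨Nat.find_spec hex, fun i hi => Nat.find_min hex hi⟩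
  -- Almost every point visits `B`, but since `m B < 1 / (N + 1)` the first `N` preimages of `B`
  -- cannot cover almost all of `X`.
  obtain ⟨k, hk⟩ : ∃ k, 0 < m (D (N + k)) := by
    by_contra! h
    have h0 : m (⋃ k, D (N + k)) = 0 := measure_iUnion_null fun k => le_antisymm (h k) zero_le
    have hle : (1 : ℝ≥0∞) ≤ N * m B := by
      calc (1 : ℝ≥0∞) = m U := hU.symm
        _ ≤ m (⋃ i ∈ Finset.range N, τ^[i] ⁻¹' B) + m (⋃ k, D (N + k)) :=
          (measure_mono hUsub).trans (measure_union_le _ _)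
        _ ≤ ∑ i ∈ Finset.range N, m (τ^[i] ⁻¹' B) := by
          rw [h0, add_zero]; exact measure_biUnion_finset_le _ _
        _ = N * m B := by
          simp [fun i => (hτ.toMeasurePreserving.iterate i).measure_preimage hB.nullMeasurableSet]
    have hlt : (N + 1 : ℝ≥0∞) * m B < 1 := by
      have := ENNReal.mul_lt_mul_right (a := (N + 1 : ℝ≥0∞)) (by simp) (by simp) hBN
      rwa [ENNReal.mul_inv_cancel (by simp) (by simp)] at this
    have : (N : ℝ≥0∞) * m B ≤ (N + 1 : ℝ≥0∞) * m B := by gcongr; exact le_self_add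
    exact absurd (hle.trans this) (not_le.2 hlt)
  refine ⟨D (N + k), hD _, hk, ?_⟩
  have hlt : ∀ i < N, ∀ j < N, i < j → Disjoint (τ^[i] ⁻¹' D (N + k)) (τ^[j] ⁻¹' D (N + k)) := by
    intro i hi j hj hij
    rw [Set.disjoint_left]
    intro x hxi hxj
    have h1 := (hmemD.1 hxi).1
    -- The visit of `x` to `B` at time `N + k + i` comes `j - i` steps too early for `τ^[j] x`.
    have h2 := (hmemD.1 hxj).2 (N + k - (j - i)) (by omega)
    rw [← Function.iterate_add_apply] at h1 h2
    rw [show N + k - (j - i) + j = N + k + i by omega] at h2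
    exact h2 h1
  intro i hi j hj hij
  rcases lt_or_gt_of_ne hij with h | h
  · exact hlt i hi j hj h
  · exact (hlt j hj i hi h).symm

/-- The Koopman operator `f ↦ f ∘ τ` on `L²`. -/
noncomputable def koopman {τ : X → X} (hτ : MeasurePreserving τ m m) :
    Lp ℂ 2 m →L[ℂ] Lp ℂ 2 m :=
  (Lp.compMeasurePreservingₗᵢ ℂ τ hτ).toContinuousLinearMap

lemma norm_koopman_apply {τ : X → X} (hτ : MeasurePreserving τ m m) (f : Lp ℂ 2 m) :
    ‖koopman hτ f‖ = ‖f‖ := Lp.norm_compMeasurePreserving f hτ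

lemma koopman_pow_apply {τ : X → X} (hτ : MeasurePreserving τ m m) (j : ℕ) (f : Lp ℂ 2 m) :
    (koopman hτ ^ j) f = Lp.compMeasurePreserving (τ^[j]) (hτ.iterate j) f := by
  rw [FunLike.coe_pow_eq_iterate, ← Lp.compMeasurePreserving_iterate hτ j]
  rfl

/-- The polynomial `(1/n) ∑_{j=1}^n X^j`. -/
noncomputable def averagePolynomial (n : ℕ) : Polynomial ℂ :=
  (n : ℂ)⁻¹ • ∑ j ∈ Finset.Icc 1 n, Polynomial.X ^ j

lemma eval_averagePolynomial (n : ℕ) (γ : Circle) :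
    (averagePolynomial n).eval (γ : ℂ) = averageSymbol n γ := by
  simp [averagePolynomial, averageSymbol, Polynomial.eval_finsetSum]

lemma aeval_averagePolynomial {τ : X → X} (hτ : MeasurePreserving τ m m) (n : ℕ) (f : Lp ℂ 2 m) :
    Polynomial.aeval (koopman hτ) (averagePolynomial n) f = ergodicAverage hτ n f := by
  simp only [averagePolynomial, ergodicAverage, map_smul, map_sum, map_pow, Polynomial.aeval_X,
    smul_apply, sum_apply, koopman_pow_apply]

/-- A polynomial in the Koopman operator of an ergodic transformation of a non-atomic space has at
least the norm of its symbol on the circle. -/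
lemma Ergodic.norm_eval_le [IsProbabilityMeasure m] (hm : IsNonatomic m) {τ : X → X}
    (hτ : Ergodic τ m) (p : Polynomial ℂ) (γ : Circle) :
    ‖p.eval (γ : ℂ)‖ ≤ ‖Polynomial.aeval (koopman hτ.toMeasurePreserving) p‖ := by
  refine norm_eval_le_of_approx_eigenvalue (fun N hN => ?_) p
  obtain ⟨A, hA, hA0, hdisj⟩ := hτ.exists_disjoint_preimages hm N
  refine exists_approx_eigenvector (norm_koopman_apply _)
    (g := indicatorConstLp 2 hA (measure_ne_top m A) (1 : ℂ)) ?_ hN ?_ γ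
  · rw [← norm_pos_iff, norm_indicatorConstLp two_ne_zero ENNReal.ofNat_ne_top]
    have : 0 < m.real A := ENNReal.toReal_pos hA0.ne' (measure_ne_top m A)
    simpa using Real.rpow_pos_of_pos this _
  · intro i hi j hj hij
    rw [koopman_pow_apply, koopman_pow_apply, Lp.indicatorConstLp_compMeasurePreserving,
      Lp.indicatorConstLp_compMeasurePreserving,
      L2.inner_indicatorConstLp_one_indicatorConstLp_one,
      Set.disjoint_iff_inter_eq_empty.1 (hdisj i hi j hj hij)]
    simp

end Dynamics

/-! ### The equivalence. -/

theorem theorem3p1 {X : Type*} [MeasurableSpace X] (m : Measure X) [IsProbabilityMeasure m]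
    (hm : IsNonatomic m) (τ : X → X) (hτ : Ergodic τ m)
    (n : ℕ → ℕ) (hn_pos : ∀ k, 1 ≤ n k) (hn : Monotone n) :
    (∀ f : Lp ℂ 2 m, UnconditionallyConvergent fun k : ℕ =>
        ergodicAverage hτ.toMeasurePreserving (n (k + 1)) f -
          ergodicAverage hτ.toMeasurePreserving (n k) f) ↔
      (⨆ γ : Circle, ∑' k : ℕ, ‖averageSymbol (n (k + 1)) γ - averageSymbol (n k) γ‖ₑ) < ⊤ := by
  set T := koopman hτ.toMeasurePreserving with hT
  let q : ℕ → Polynomial ℂ := fun k => averagePolynomial (n (k + 1)) - averagePolynomial (n k)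
  have hqT (k : ℕ) (f : Lp ℂ 2 m) : ergodicAverage hτ.toMeasurePreserving (n (k + 1)) f -
      ergodicAverage hτ.toMeasurePreserving (n k) f = Polynomial.aeval T (q k) f := by
    simp only [q, hT, map_sub, sub_apply, aeval_averagePolynomial]
  have hqγ (k : ℕ) (γ : Circle) : averageSymbol (n (k + 1)) γ - averageSymbol (n k) γ =
      (q k).eval (γ : ℂ) := by
    simp only [q, Polynomial.eval_sub, eval_averagePolynomial]
  simp only [hqT, hqγ, unconditionallyConvergent_iff_summable]
  constructor
  · intro h
    obtain ⟨C, hC⟩ := banach_steinhaus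
      (g := fun F : Finset ℕ => Polynomial.aeval T (∑ k ∈ F, q k)) fun f => by
        obtain ⟨C, hC⟩ := (h f).exists_norm_sum_le
        exact ⟨C, fun F => by simpa only [map_sum, sum_apply] using hC F⟩
    refine lt_of_le_of_lt (iSup_le fun γ => ?_) (ENNReal.ofReal_lt_top (r := 4 * C))
    rw [ENNReal.tsum_eq_iSup_sum]
    refine iSup_le fun F => ?_
    have := sum_norm_le_of_forall_norm_sum_le (a := fun k => (q k).eval (γ : ℂ)) (C := C)
      (fun F => by
        rw [← Polynomial.eval_finsetSum]
        exact (hτ.norm_eval_le hm _ γ).trans (hC F)) F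
    calc ∑ k ∈ F, ‖(q k).eval (γ : ℂ)‖ₑ = ENNReal.ofReal (∑ k ∈ F, ‖(q k).eval (γ : ℂ)‖) := by
          rw [ENNReal.ofReal_sum_of_nonneg fun _ _ => norm_nonneg _]
          simp only [ofReal_norm]
      _ ≤ _ := ENNReal.ofReal_le_ofReal this
  · intro h f
    set S := ⨆ γ : Circle, ∑' k : ℕ, ‖(q k).eval (γ : ℂ)‖ₑ
    refine summable_of_forall_norm_sum_smul_le (C := S.toReal * ‖f‖) fun F c hc => ?_
    -- The bound is uniform in `F` and `c`, so von Neumann's inequality makes the series weakly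
    -- unconditionally Cauchy.
    have hp (γ : Circle) : ‖(∑ k ∈ F, c k • q k).eval (γ : ℂ)‖ ≤ S.toReal := by
      have hF : ∑ k ∈ F, ‖(q k).eval (γ : ℂ)‖ ≤ S.toReal := by
        rw [← ENNReal.ofReal_le_iff_le_toReal h.ne,
          ENNReal.ofReal_sum_of_nonneg fun _ _ => norm_nonneg _]
        simp only [ofReal_norm]
        exact (ENNReal.sum_le_tsum F).trans
          (le_iSup (fun γ : Circle => ∑' k : ℕ, ‖(q k).eval (γ : ℂ)‖ₑ) γ)
      rw [Polynomial.eval_finsetSum]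
      refine (norm_sum_le _ _).trans ((Finset.sum_le_sum fun k _ => ?_).trans hF)
      rw [Polynomial.eval_smul, norm_smul]
      exact mul_le_of_le_one_left (norm_nonneg _) (hc k)
    have := norm_aeval_apply_le_of_isometry (norm_koopman_apply hτ.toMeasurePreserving) _ hp f
    simpa only [map_sum, map_smul, sum_apply, smul_apply] using this
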